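/- Let $n\ge 3$, $A\in\mathbb R^{n\times n}$, $B\in\mathbb R^{n\times m}$, $D\in\mathbb R^{n\times p}$ with $D\neq 0$ and $\{A,B\}$ controllable, and let $Q\in\mathbb R^{p\times p}$ be symmetric positive definite. Consider the plant $$\dot x(t)=Ax(t)+Bu(x(t))+D\omega(t),\qquad \omega\in L^\infty(\mathbb R_+,\mathbb R^p),\quad \omega(t)^\top Q\,\omega(t)\le 1 \text{ for almost all } t>0. \tag{1}$$ *Controller.* Let $G_0\in\mathbb R^{n\times n}$, $Y_0\in\mathbb R^{m\times n}$ satisfy $AG_0-G_0A+BY_0=A$ and $G_0B=0$. Let $\tilde n$ be the least natural number with $\operatorname{rank}[B,AB,\dots,A^{\tilde n-1}B]=n$, let $\mu\in[-1,1/\tilde n]$, and put $G_{\mathbf d}=I_n+\mu G_0$, $\mathbf d(s)=e^{sG_{\mathbf d}}$, $K_0=Y_0(G_0-I_n)^{-1}$, $A_0=A+BK_0$ (under these assumptions $G_0-I_n$ is invertible and $G_{\mathbf d}$ is anti-Hurwitz, i.e. all its eigenvalues have positive real part). Let $X\in\mathbb R^{n\times n}$ be invertible, $K\in\mathbb R^{m\times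 n}$, $P=X^{-1}$, and $$u(x)=K_0x+\|x\|_{\mathbf d,P}^{\mu+1}\,K\,\mathbf d(-\ln\|x\|_{\mathbf d,P})\,x .$$ Here $\|x\|_P=\sqrt{x^\top Px}$, and $\|\cdot\|_{\mathbf d,P}$ is the canonical homogeneous norm: $\|0\|_{\mathbf d,P}=0$, and for $x\ne0$, $\|x\|_{\mathbf d,P}=e^{s}$ with $\|\mathbf d(-s)x\|_P=1$. It is well defined if $P\succ0$ and $\mathbf d$ is strictly monotone with respect to $\|\cdot\|_P$, i.e. for some $b>0$, $\|\mathbf d(s)x\|_P\le e^{bs}\|x\|_P$ for all $s\le 0$ and all $x\in\mathbb R^n$. *Homogeneity.* Let $\mathbf d_\omega(s)=e^{sG_\omega}$ with $G_\omega\in\mathbb R^{p\times p}$ anti-Hurwitz, and put $\tilde{\mathbf d}(s)=\operatorname{diag}(\mathbf d(s),\mathbf d_\omega(s))$. Assume that the vector field $\tilde f(x,\omega)=(Ax+Bu(x)+D\omega,\;0)$ on $\mathbb R^{n+p}$ is $\tilde{\mathbf d}$-homogeneous of degree $\mu$, i.e. $\tilde f(\tilde{\mathbf d}(s)z)=e^{\mu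 s}\,\tilde{\mathbf d}(s)\tilde f(z)$ for all $z\in\mathbb R^{n+p}\setminus\{0\}$ and $s\in\mathbb R$. *Invariance.* The set $\varepsilon_{\mathbf d}(P)=\{x\in\mathbb R^n:\|x\|_{\mathbf d,P}\le 1\}$ is called an invariant $\mathbf d$-homogeneous ellipsoid of (1) if $P\succ0$, $\mathbf d$ is strictly monotone with respect to $\|\cdot\|_P$, and for every admissible $\omega$, every $T>0$ and every solution $x$ of (1) on $[0,T]$, $x(0)\in\varepsilon_{\mathbf d}(P)$ implies $x(t)\in\varepsilon_{\mathbf d}(P)$ for all $t\in[0,T]$. Solutions are absolutely continuous functions that satisfy (1) almost everywhere; at states where $u$ is discontinuous (this concerns only $x=0$ with $\mu=-1$) the equation is understood in the sense of Filippov. **Theorem.** The $\mathbf d$-homogeneous ellipsoid $\varepsilon_{\mathbf d}(X^{-1})$ is invariant for (1) if and only if there exists $\beta>0$ such that $$\begin{bmatrix}A_0X+XA_0^\top+BY+Y^\top B^\top+\beta X & D\\ D^\top & -\beta Q\end{bmatrix}\preceq 0,\qquad G_{\mathbf d}X+XG_{\mathbf d}^\top\succ0,\qquad X\succ0,$$ where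 $Y=KX$. -/

import Mathlib

open Matrix MeasureTheory Set
open scoped ENNReal

noncomputable section

namespace HomEllipsoid

/-! ### Controllability -/

/-- The block matrix `[B, AB, …, A^{k-1}B]`; its columns are indexed by pairs (power, column). -/
def ctrbMatrix {n m : ℕ} (A : Matrix (Fin n) (Fin n) ℝ) (B : Matrix (Fin n) (Fin m) ℝ) (k : ℕ) :
    Matrix (Fin n) (Fin k × Fin m) ℝ :=
  Matrix.of fun i jl => (A ^ (jl.1 : ℕ) * B) i jl.2

/-- The pair `{A, B}` is controllable: `rank [B, AB, …, A^{n-1}B] = n`. -/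
def Controllable {n m : ℕ} (A : Matrix (Fin n) (Fin n) ℝ) (B : Matrix (Fin n) (Fin m) ℝ) : Prop :=
  (ctrbMatrix A B n).rank = n

/-- The least natural number `k` with `rank [B, AB, …, A^{k-1}B] = n`
(such a number exists when the pair is controllable). -/
def ctrbIndex {n m : ℕ} (A : Matrix (Fin n) (Fin n) ℝ) (B : Matrix (Fin n) (Fin m) ℝ) : ℕ :=
  sInf {k : ℕ | (ctrbMatrix A B k).rank = n}

/-! ### Linear dilations, homogeneity, homogeneous norm -/

/-- A real square matrix is anti-Hurwitz if all its complex eigenvalues have positive real part. -/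
def IsAntiHurwitz {ι : Type*} [Fintype ι] [DecidableEq ι] (G : Matrix ι ι ℝ) : Prop :=
  ∀ z ∈ spectrum ℂ (G.map (algebraMap ℝ ℂ)), 0 < z.re

/-- The linear dilation `s ↦ exp (s G)` with generator `G`. -/
def dilation {ι : Type*} [Fintype ι] [DecidableEq ι] (G : Matrix ι ι ℝ) (s : ℝ) : Matrix ι ι ℝ :=
  NormedSpace.exp (s • G)

/-- A vector field `f` is homogeneous of degree `ν` with respect to the one-parameter family `d`. -/
def IsHomogeneousField {ι : Type*} [Fintype ι] (d : ℝ → Matrix ι ι ℝ) (ν : ℝ)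
    (f : (ι → ℝ) → (ι → ℝ)) : Prop :=
  ∀ x : ι → ℝ, x ≠ 0 → ∀ s : ℝ, f (d s *ᵥ x) = Real.exp (ν * s) • (d s *ᵥ f x)

/-- The weighted norm `‖x‖_P = √(xᵀ P x)`. -/
def wnorm {n : ℕ} (P : Matrix (Fin n) (Fin n) ℝ) (x : Fin n → ℝ) : ℝ :=
  Real.sqrt (x ⬝ᵥ (P *ᵥ x))

/-- The dilation with generator `G` is strictly monotone with respect to `‖·‖_P`: for some `b > 0`
the operator norm of `exp (s G)` induced by `‖·‖_P` is at most `e^{b s}` for all `s ≤ 0`. -/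
def IsStrictlyMonotone {n : ℕ} (P G : Matrix (Fin n) (Fin n) ℝ) : Prop :=
  ∃ b : ℝ, 0 < b ∧ ∀ s : ℝ, s ≤ 0 → ∀ x : Fin n → ℝ,
    wnorm P (dilation G s *ᵥ x) ≤ Real.exp (b * s) * wnorm P x

/-- The canonical homogeneous norm `‖x‖_{d,P}`: it is `0` at `x = 0`, and `e^s` with
`‖d(-s) x‖_P = 1` at `x ≠ 0`. (The number `s` exists and is unique if `P` is positive definite and
the dilation is strictly monotone with respect to `‖·‖_P`.) -/
def homNorm {n : ℕ} (P G : Matrix (Fin n) (Fin n) ℝ) (x : Fin n → ℝ) : ℝ :=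
  open Classical in
  if x = 0 then 0
  else Real.exp (Classical.epsilon fun s : ℝ => wnorm P (dilation G (-s) *ᵥ x) = 1)

/-- The homogeneous ellipsoid `ε_d(P) = {x | ‖x‖_{d,P} ≤ 1}`. -/
def homEllipsoid {n : ℕ} (P G : Matrix (Fin n) (Fin n) ℝ) : Set (Fin n → ℝ) :=
  {x | homNorm P G x ≤ 1}

/-! ### Perturbed systems and invariance -/

/-- The Filippov set-valued regularization of a vector field `g` at the point `x`. It equals
`{g x}` wherever `g` is continuous. -/
def filippov {n : ℕ} (g : (Fin n → ℝ) → (Fin n → ℝ)) (x : Fin n → ℝ) : Set (Fin n → ℝ) :=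
  ⋂ (δ : ℝ) (_ : 0 < δ) (N : Set (Fin n → ℝ)) (_ : volume N = 0),
    closure (convexHull ℝ (g '' (Metric.ball x δ \ N)))

/-- Admissible perturbations: `ω ∈ L^∞(ℝ₊, ℝᵖ)` with `ω(t)ᵀ Q ω(t) ≤ 1` for almost all `t > 0`. -/
def IsAdmissible {p : ℕ} (Q : Matrix (Fin p) (Fin p) ℝ) (ω : ℝ → (Fin p → ℝ)) : Prop :=
  MemLp ω ∞ (volume.restrict (Ioi 0)) ∧
    ∀ᵐ t ∂(volume.restrict (Ioi (0 : ℝ))), ω t ⬝ᵥ (Q *ᵥ ω t) ≤ 1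

/-- `x` is a solution on `[0, T]` of `ẋ = f(x, ω(t))`: it is absolutely continuous and satisfies
the equation almost everywhere, in the sense of Filippov. For `f` continuous in `x` these are the
usual Carathéodory solutions. -/
def IsSolutionOn {n p : ℕ} (f : (Fin n → ℝ) → (Fin p → ℝ) → (Fin n → ℝ)) (ω : ℝ → (Fin p → ℝ))
    (T : ℝ) (x : ℝ → (Fin n → ℝ)) : Prop :=
  AbsolutelyContinuousOnInterval x 0 T ∧
    ∀ᵐ t ∂(volume.restrict (Ioo (0 : ℝ) T)),
      ∃ v ∈ filippov (fun y => f y (ω t)) (x t), HasDerivAt x v t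

/-- `ε_d(P)` is an invariant homogeneous ellipsoid of `ẋ = f(x, ω)`. The canonical homogeneous norm
has to be well defined (`P ≻ 0` and the dilation strictly monotone with respect to `‖·‖_P`), and
every solution that starts in `ε_d(P)` stays there as long as it exists, for every admissible
perturbation. -/
def IsInvariantEllipsoid {n p : ℕ} (f : (Fin n → ℝ) → (Fin p → ℝ) → (Fin n → ℝ))
    (Q : Matrix (Fin p) (Fin p) ℝ) (P G : Matrix (Fin n) (Fin n) ℝ) : Prop :=
  P.PosDef ∧ IsStrictlyMonotone P G ∧
    ∀ ω : ℝ → (Fin p → ℝ), IsAdmissible Q ω →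
      ∀ T : ℝ, 0 < T → ∀ x : ℝ → (Fin n → ℝ), IsSolutionOn f ω T x →
        x 0 ∈ homEllipsoid P G → ∀ t ∈ Icc 0 T, x t ∈ homEllipsoid P G

/-! ### The homogeneous controller and the closed-loop system -/

/-- The generator `G_d = I + μ G₀`. -/
def genG {n : ℕ} (G₀ : Matrix (Fin n) (Fin n) ℝ) (μ : ℝ) : Matrix (Fin n) (Fin n) ℝ :=
  1 + μ • G₀

/-- The gain `K₀ = Y₀ (G₀ - I)⁻¹`. -/
def gainK₀ {n m : ℕ} (G₀ : Matrix (Fin n) (Fin n) ℝ) (Y₀ : Matrix (Fin m) (Fin n) ℝ) :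
    Matrix (Fin m) (Fin n) ℝ :=
  Y₀ * (G₀ - 1)⁻¹

/-- The matrix `A₀ = A + B Y₀ (G₀ - I)⁻¹`. -/
def matA₀ {n m : ℕ} (A : Matrix (Fin n) (Fin n) ℝ) (B : Matrix (Fin n) (Fin m) ℝ)
    (G₀ : Matrix (Fin n) (Fin n) ℝ) (Y₀ : Matrix (Fin m) (Fin n) ℝ) : Matrix (Fin n) (Fin n) ℝ :=
  A + B * (Y₀ * (G₀ - 1)⁻¹)

/-- The feedback `u(x) = K₀ x + ‖x‖_{d,P}^{μ+1} K d(-ln ‖x‖_{d,P}) x` with `P = X⁻¹`. -/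
def controller {n m : ℕ} (G₀ : Matrix (Fin n) (Fin n) ℝ) (Y₀ K : Matrix (Fin m) (Fin n) ℝ)
    (X : Matrix (Fin n) (Fin n) ℝ) (μ : ℝ) (x : Fin n → ℝ) : Fin m → ℝ :=
  gainK₀ G₀ Y₀ *ᵥ x +
    (homNorm X⁻¹ (genG G₀ μ) x) ^ (μ + 1) •
      (K *ᵥ (dilation (genG G₀ μ) (-Real.log (homNorm X⁻¹ (genG G₀ μ) x)) *ᵥ x))

/-- The closed-loop right-hand side `f(x, ω) = A x + B u(x) + D ω`. -/
def closedLoop {n m p : ℕ} (A : Matrix (Fin n) (Fin n) ℝ) (B : Matrix (Fin n) (Fin m) ℝ)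
    (D : Matrix (Fin n) (Fin p) ℝ) (u : (Fin n → ℝ) → (Fin m → ℝ))
    (x : Fin n → ℝ) (w : Fin p → ℝ) : Fin n → ℝ :=
  A *ᵥ x + B *ᵥ u x + D *ᵥ w

/-- The augmented vector field `(x, ω) ↦ (f(x, ω), 0)` on `ℝⁿ⁺ᵖ`. -/
def augField {n p : ℕ} (f : (Fin n → ℝ) → (Fin p → ℝ) → (Fin n → ℝ))
    (z : Fin n ⊕ Fin p → ℝ) : Fin n ⊕ Fin p → ℝ :=
  Sum.elim (f (fun i => z (Sum.inl i)) (fun j => z (Sum.inr j))) 0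

/-- The block dilation `diag(d, d_ω)` on `ℝⁿ⁺ᵖ`. -/
def blockDilation {n p : ℕ} (G : Matrix (Fin n) (Fin n) ℝ) (Gω : Matrix (Fin p) (Fin p) ℝ)
    (s : ℝ) : Matrix (Fin n ⊕ Fin p) (Fin n ⊕ Fin p) ℝ :=
  Matrix.fromBlocks (dilation G s) 0 0 (dilation Gω s)

/-- The block matrix `[[A₀X + XA₀ᵀ + BY + YᵀBᵀ + βX, D], [Dᵀ, -βQ]]`. -/
def matW {n m p : ℕ} (A₀ : Matrix (Fin n) (Fin n) ℝ) (B : Matrix (Fin n) (Fin m) ℝ)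
    (D : Matrix (Fin n) (Fin p) ℝ) (Q : Matrix (Fin p) (Fin p) ℝ) (X : Matrix (Fin n) (Fin n) ℝ)
    (Y : Matrix (Fin m) (Fin n) ℝ) (β : ℝ) : Matrix (Fin n ⊕ Fin p) (Fin n ⊕ Fin p) ℝ :=
  Matrix.fromBlocks (A₀ * X + X * A₀ᵀ + B * Y + Yᵀ * Bᵀ + β • X) D Dᵀ (-(β • Q))

end HomEllipsoid

end

/-!
Write `P = X⁻¹` and `V(x) = xᵀPx`. When `P ≻ 0` and the dilation is strictly monotone, `V` is
strictly decreasing along `s ↦ d(-s)x`, so `‖x‖_{d,P} ≤ 1` says the same as `V(x) ≤ 1`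
(`mem_homEllipsoid_iff`): as a set, the homogeneous ellipsoid is an ordinary one. Strict monotonicity
is the Lyapunov inequality `G_d X + X G_dᵀ ≻ 0` (`isStrictlyMonotone_iff`,
`posDef_mul_add_mul_transpose_iff`). On the boundary `V(x) = 1` the controller is linear and the
velocity is `(A₀ + BK)x + Dω`. The theorem reduces to two equivalences with the condition

  `xᵀP((A₀ + BK)x + Dω) ≤ 0` whenever `xᵀPx = 1` and `ωᵀQω ≤ 1`.   (⋆)

*The matrix inequality and (⋆).* After the congruence `x = Xξ` the matrix inequality reads
`2xᵀP((A₀ + BK)x + Dω) ≤ β(ωᵀQω - xᵀPx)`, which gives (⋆) at once. The converse is the lossless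
S-procedure for two quadratic forms (`exists_multiplier`); it yields `β ≥ 0`, and `β ≠ 0` because
`D ≠ 0` (`exists_posSemidef_neg_matW`).

*Invariance from (⋆).* The closed loop is the restriction to `s = ln ‖x‖_{d,P}` of a field that is
smooth in `(s, x)` (`sliceField`). By compactness (⋆) persists just outside the ellipsoid up to an
error `O(s) = O(V - 1)`, so `V̇ ≤ k(V - 1)` there (`exists_form_velocity_le`), and a Gronwall argument
for absolutely continuous functions keeps `V ≤ 1` (`nonpos_of_ae_deriv_le_mul`). Away from the origin
`‖·‖_{d,P}` is continuous, so that Filippov solutions are ordinary ones there; the origin itself, where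
the field may be discontinuous, plays no role.

*(⋆) from invariance.* If (⋆) failed at `(x₀, ω₀)`, a solution starting at `x₀` with the constant
perturbation `ω₀` would leave the ellipsoid at once. The solution comes from the Picard–Lindelöf
theorem for a `C¹` field in the unknowns `(s, x)` that conserves `‖d(-s)x‖_P`
(`exists_isSolutionOn`), so no differentiability of the homogeneous norm is needed.
-/

open Matrix MeasureTheory Set
open scoped ENNReal

noncomputable section

namespace HomEllipsoid

/-! ### Positive definite quadratic forms -/

theorem transpose_eq_of_posDef {ι : Type*} {M : Matrix ι ι ℝ} (hM : M.PosDef) :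
    Mᵀ = M := by
  rw [← conjTranspose_eq_transpose_of_trivial]; exact hM.isHermitian

section Forms

variable {ι : Type*} [Fintype ι]

theorem dotProduct_mulVec_comm_of_posDef {P : Matrix ι ι ℝ} (hP : P.PosDef) (x y : ι → ℝ) :
    x ⬝ᵥ (P *ᵥ y) = y ⬝ᵥ (P *ᵥ x) := by
  rw [dotProduct_mulVec, dotProduct_comm, ← mulVec_transpose, transpose_eq_of_posDef hP]

theorem dotProduct_mulVec_self_pos {P : Matrix ι ι ℝ} (hP : P.PosDef) {x : ι → ℝ} (hx : x ≠ 0) :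
    0 < x ⬝ᵥ (P *ᵥ x) := by
  simpa using hP.dotProduct_mulVec_pos hx

theorem dotProduct_mulVec_self_nonneg {P : Matrix ι ι ℝ} (hP : P.PosDef) (x : ι → ℝ) :
    0 ≤ x ⬝ᵥ (P *ᵥ x) := by
  simpa using hP.posSemidef.dotProduct_mulVec_nonneg x

theorem smul_form (M : Matrix ι ι ℝ) (c : ℝ) (x : ι → ℝ) :
    (c • x) ⬝ᵥ (M *ᵥ (c • x)) = c ^ 2 * (x ⬝ᵥ (M *ᵥ x)) := by
  rw [mulVec_smul, dotProduct_smul, smul_dotProduct, smul_eq_mul, smul_eq_mul]; ring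

theorem continuous_form (M : Matrix ι ι ℝ) : Continuous fun x : ι → ℝ => x ⬝ᵥ (M *ᵥ x) := by
  fun_prop

/-- A positive quadratic form dominates a multiple of any other, by compactness of the unit
sphere. -/
theorem exists_pos_mul_form_le (M N : Matrix ι ι ℝ) (hM : ∀ x, x ≠ 0 → 0 < x ⬝ᵥ (M *ᵥ x))
    (hN : ∀ x, x ≠ 0 → 0 < x ⬝ᵥ (N *ᵥ x)) :
    ∃ b : ℝ, 0 < b ∧ ∀ x, b * (x ⬝ᵥ (N *ᵥ x)) ≤ x ⬝ᵥ (M *ᵥ x) := by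
  rcases isEmpty_or_nonempty ι with h | h
  · exact ⟨1, one_pos, fun x => by simp [Subsingleton.elim x 0]⟩
  have hne : ∀ x ∈ Metric.sphere (0 : ι → ℝ) 1, x ≠ 0 := fun x hx h0 => by simp [h0] at hx
  have hcont : ContinuousOn (fun x : ι → ℝ => (x ⬝ᵥ (M *ᵥ x)) / (x ⬝ᵥ (N *ᵥ x)))
      (Metric.sphere 0 1) :=
    (continuous_form M).continuousOn.div (continuous_form N).continuousOn
      fun x hx => (hN x (hne x hx)).ne'
  obtain ⟨z, hz, hmin⟩ := (isCompact_sphere (0 : ι → ℝ) 1).exists_isMinOn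
    (NormedSpace.sphere_nonempty.2 zero_le_one) hcont
  refine ⟨_, div_pos (hM z (hne z hz)) (hN z (hne z hz)), fun x => ?_⟩
  by_cases hx : x = 0
  · simp [hx]
  have hx' : ‖x‖ ≠ 0 := norm_ne_zero_iff.2 hx
  have h1 := isMinOn_iff.1 hmin (‖x‖⁻¹ • x) (by simp [norm_smul, hx'])
  rw [smul_form, smul_form, mul_div_mul_left _ _ (by positivity)] at h1
  exact (le_div_iff₀ (hN x hx)).1 h1

/-- Sublevel sets of a positive definite form are compact. -/
theorem isCompact_form_le {P : Matrix ι ι ℝ} (hP : P.PosDef) (c : ℝ) :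
    IsCompact {x : ι → ℝ | x ⬝ᵥ (P *ᵥ x) ≤ c} := by
  classical
  refine Metric.isCompact_of_isClosed_isBounded
    (isClosed_le (continuous_form P) continuous_const) ?_
  obtain ⟨b, hb, h⟩ := exists_pos_mul_form_le P 1 (fun x hx => dotProduct_mulVec_self_pos hP hx)
    (fun x hx => dotProduct_mulVec_self_pos PosDef.one hx)
  refine (Metric.isBounded_closedBall (x := (0 : ι → ℝ)) (r := Real.sqrt (c / b))).subset ?_
  intro x hx
  rw [mem_closedBall_zero_iff, pi_norm_le_iff_of_nonneg (Real.sqrt_nonneg _)]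
  intro i
  rw [Real.norm_eq_abs, ← Real.sqrt_sq_eq_abs]
  refine Real.sqrt_le_sqrt ((le_div_iff₀' hb).2 ?_)
  refine le_trans ?_ ((h x).trans hx)
  gcongr
  rw [one_mulVec, sq]
  exact Finset.single_le_sum (f := fun i => x i * x i) (fun j _ => mul_self_nonneg _)
    (Finset.mem_univ i)

theorem hasDerivAt_form {P : Matrix ι ι ℝ} (hP : P.PosDef) {x : ℝ → ι → ℝ} {v : ι → ℝ} {t : ℝ}
    (hx : HasDerivAt x v t) :
    HasDerivAt (fun t => x t ⬝ᵥ (P *ᵥ x t)) (2 * (x t ⬝ᵥ (P *ᵥ v))) t := by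
  have hi := hasDerivAt_pi.1 hx
  have h : HasDerivAt (fun t => x t ⬝ᵥ (P *ᵥ x t)) (v ⬝ᵥ (P *ᵥ x t) + x t ⬝ᵥ (P *ᵥ v)) t := by
    simp only [dotProduct, mulVec, ← Finset.sum_add_distrib]
    exact HasDerivAt.fun_sum fun i _ => (hi i).mul
      (HasDerivAt.fun_sum fun j _ => (hi j).const_mul _)
  rw [dotProduct_mulVec_comm_of_posDef hP v (x t)] at h
  exact h.congr_deriv (by ring)

end Forms

/-! ### Linear dilations -/

section Dilation

variable {n : ℕ} (G : Matrix (Fin n) (Fin n) ℝ)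

@[simp] theorem dilation_zero : dilation G 0 = 1 := by simp [dilation]

theorem dilation_add (s t : ℝ) : dilation G (s + t) = dilation G s * dilation G t := by
  rw [dilation, add_smul]
  exact Matrix.exp_add_of_commute _ _ (((Commute.refl G).smul_left s).smul_right t)

theorem dilation_mulVec_mulVec (s t : ℝ) (x : Fin n → ℝ) :
    dilation G s *ᵥ (dilation G t *ᵥ x) = dilation G (s + t) *ᵥ x := by
  rw [dilation_add, mulVec_mulVec]

theorem dilation_mulVec_ne_zero (s : ℝ) {x : Fin n → ℝ} (hx : x ≠ 0) :
    dilation G s *ᵥ x ≠ 0 := fun h => hx <| by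
  have := dilation_mulVec_mulVec G (-s) s x
  simpa [h] using this.symm

open scoped Matrix.Norms.Operator in
theorem hasDerivAt_dilation_apply (s : ℝ) (i j : Fin n) :
    HasDerivAt (fun s => dilation G s i j) ((G * dilation G s) i j) s := by
  have h := hasDerivAt_exp_smul_const' (𝕂 := ℝ) G s
  exact hasDerivAt_pi.1 (hasDerivAt_pi.1 h i) j

theorem contDiff_dilation_apply (i j : Fin n) : ContDiff ℝ 1 fun s => dilation G s i j := by
  have hd : ∀ i j, Differentiable ℝ fun s => dilation G s i j := fun i j s =>
    (hasDerivAt_dilation_apply G s i j).differentiableAt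
  refine contDiff_one_iff_deriv.2 ⟨hd i j, ?_⟩
  rw [funext fun s => (hasDerivAt_dilation_apply G s i j).deriv]
  simp only [mul_apply]
  exact continuous_finsetSum _ fun k _ => continuous_const.mul (hd k j).continuous

theorem hasDerivAt_dilation_mulVec {s : ℝ → ℝ} {x : ℝ → Fin n → ℝ} {s' : ℝ} {v : Fin n → ℝ}
    {t : ℝ} (hs : HasDerivAt s s' t) (hx : HasDerivAt x v t) :
    HasDerivAt (fun t => dilation G (s t) *ᵥ x t)
      (s' • (G *ᵥ (dilation G (s t) *ᵥ x t)) + dilation G (s t) *ᵥ v) t := by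
  rw [hasDerivAt_pi]
  intro i
  have h : HasDerivAt (fun t => ∑ j, dilation G (s t) i j * x t j)
      (∑ j, (((G * dilation G (s t)) i j * s') * x t j + dilation G (s t) i j * v j)) t :=
    HasDerivAt.fun_sum fun j _ =>
      ((hasDerivAt_dilation_apply G (s t) i j).comp t hs).mul (hasDerivAt_pi.1 hx j)
  refine h.congr_deriv ?_
  rw [mulVec_mulVec]
  simp only [Finset.sum_add_distrib, Pi.add_apply, Pi.smul_apply, mulVec,
    dotProduct, smul_eq_mul, Finset.mul_sum]
  congr 1
  exact Finset.sum_congr rfl fun j _ => by ring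

theorem hasDerivAt_dilation_mulVec_const (s : ℝ) (x : Fin n → ℝ) :
    HasDerivAt (fun s => dilation G s *ᵥ x) (G *ᵥ (dilation G s *ᵥ x)) s := by
  simpa using hasDerivAt_dilation_mulVec G (hasDerivAt_id s) (hasDerivAt_const s x)

theorem contDiff_mulVec {E : Type*} [NormedAddCommGroup E] [NormedSpace ℝ E] {k l : Type*}
    [Fintype k] [Fintype l] {M : E → Matrix k l ℝ} {x : E → l → ℝ}
    (hM : ∀ i j, ContDiff ℝ 1 fun e => M e i j) (hx : ContDiff ℝ 1 x) :
    ContDiff ℝ 1 fun e => M e *ᵥ x e :=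
  contDiff_pi.2 fun i => ContDiff.sum fun j _ => (hM i j).mul (contDiff_pi.1 hx j)

theorem contDiff_const_mulVec {E : Type*} [NormedAddCommGroup E] [NormedSpace ℝ E] {k l : Type*}
    [Fintype k] [Fintype l] (M : Matrix k l ℝ) {x : E → l → ℝ} (hx : ContDiff ℝ 1 x) :
    ContDiff ℝ 1 fun e => M *ᵥ x e :=
  contDiff_mulVec (M := fun _ => M) (fun _ _ => contDiff_const) hx

theorem contDiff_dotProduct {E : Type*} [NormedAddCommGroup E] [NormedSpace ℝ E] {k : Type*}
    [Fintype k] {x y : E → k → ℝ} (hx : ContDiff ℝ 1 x) (hy : ContDiff ℝ 1 y) :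
    ContDiff ℝ 1 fun e => x e ⬝ᵥ y e :=
  ContDiff.sum fun j _ => (contDiff_pi.1 hx j).mul (contDiff_pi.1 hy j)

theorem contDiff_dilation_mulVec {E : Type*} [NormedAddCommGroup E] [NormedSpace ℝ E]
    {s : E → ℝ} {x : E → Fin n → ℝ} (hs : ContDiff ℝ 1 s) (hx : ContDiff ℝ 1 x) :
    ContDiff ℝ 1 fun e => dilation G (s e) *ᵥ x e :=
  contDiff_mulVec (fun i j => (contDiff_dilation_apply G i j).comp hs) hx

end Dilation

/-! ### Strict monotonicity and the canonical homogeneous norm -/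

section Monotone

variable {n : ℕ} {P G : Matrix (Fin n) (Fin n) ℝ}

theorem sq_wnorm (hP : P.PosDef) (x : Fin n → ℝ) : wnorm P x ^ 2 = x ⬝ᵥ (P *ᵥ x) :=
  Real.sq_sqrt (dotProduct_mulVec_self_nonneg hP x)

theorem wnorm_eq_one_iff (x : Fin n → ℝ) : wnorm P x = 1 ↔ x ⬝ᵥ (P *ᵥ x) = 1 :=
  Real.sqrt_eq_one

theorem hasDerivAt_form_dilation (hP : P.PosDef) (s : ℝ) (x : Fin n → ℝ) :
    HasDerivAt (fun s => (dilation G s *ᵥ x) ⬝ᵥ (P *ᵥ (dilation G s *ᵥ x)))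
      (2 * ((dilation G s *ᵥ x) ⬝ᵥ ((P * G) *ᵥ (dilation G s *ᵥ x)))) s := by
  have := hasDerivAt_form hP (hasDerivAt_dilation_mulVec_const G s x)
  rwa [mulVec_mulVec] at this

/-- Exponential growth of the form `xᵀPx` along the dilation for positive parameters; this is
strict monotonicity read from `d(s)x` back to `x`. -/
theorem IsStrictlyMonotone.exists_exp_mul_le (hP : P.PosDef) (h : IsStrictlyMonotone P G) :
    ∃ b : ℝ, 0 < b ∧ ∀ s : ℝ, 0 ≤ s → ∀ x : Fin n → ℝ,
      Real.exp (2 * b * s) * (x ⬝ᵥ (P *ᵥ x)) ≤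
        (dilation G s *ᵥ x) ⬝ᵥ (P *ᵥ (dilation G s *ᵥ x)) := by
  obtain ⟨b, hb, h⟩ := h
  refine ⟨b, hb, fun s hs x => ?_⟩
  have h1 := h (-s) (by linarith) (dilation G s *ᵥ x)
  rw [dilation_mulVec_mulVec, neg_add_cancel, dilation_zero, one_mulVec] at h1
  have h2 := pow_le_pow_left₀ (Real.sqrt_nonneg _) h1 2
  rw [mul_pow] at h2
  change wnorm P x ^ 2 ≤ _ at h2
  rw [sq_wnorm hP, sq_wnorm hP, ← Real.exp_nat_mul] at h2
  calc Real.exp (2 * b * s) * (x ⬝ᵥ (P *ᵥ x))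
      ≤ Real.exp (2 * b * s) * (Real.exp ((2 : ℕ) * (b * -s)) * _) := by gcongr
    _ = _ := by
      rw [← mul_assoc, ← Real.exp_add]
      simp only [Nat.cast_ofNat]
      ring_nf
      simp

theorem isStrictlyMonotone_iff (hP : P.PosDef) :
    IsStrictlyMonotone P G ↔ ∀ x : Fin n → ℝ, x ≠ 0 → 0 < x ⬝ᵥ ((P * G) *ᵥ x) := by
  constructor
  · intro h x hx
    obtain ⟨b, hb, h⟩ := h.exists_exp_mul_le hP
    have hV := dotProduct_mulVec_self_pos hP hx
    -- `φ` is nonnegative on `[0, ∞)` and vanishes at `0`, so its derivative at `0` is nonnegative.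
    have hd : HasDerivAt (fun s => (dilation G s *ᵥ x) ⬝ᵥ (P *ᵥ (dilation G s *ᵥ x)) -
        Real.exp (2 * b * s) * (x ⬝ᵥ (P *ᵥ x)))
        (2 * (x ⬝ᵥ ((P * G) *ᵥ x)) - 2 * b * (x ⬝ᵥ (P *ᵥ x))) 0 := by
      have h1 := hasDerivAt_form_dilation (G := G) hP 0 x
      have h2 : HasDerivAt (fun s : ℝ => Real.exp (2 * b * s)) (2 * b) 0 := by
        simpa using ((hasDerivAt_id (0 : ℝ)).const_mul (2 * b)).exp
      have h3 := h1.fun_sub (h2.mul_const (x ⬝ᵥ (P *ᵥ x)))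
      rwa [dilation_zero, one_mulVec] at h3
    have hmin : 0 ≤ 2 * (x ⬝ᵥ ((P * G) *ᵥ x)) - 2 * b * (x ⬝ᵥ (P *ᵥ x)) := by
      have h3 := (hasDerivAt_iff_tendsto_slope_zero.1 hd).mono_left
        (nhdsWithin_mono 0 (s := Ioi (0 : ℝ)) fun t (ht : 0 < t) => ht.ne')
      refine ge_of_tendsto h3 ?_
      filter_upwards [self_mem_nhdsWithin] with t ht
      have ht : 0 < t := ht
      have := h t ht.le x
      simp only [zero_add, dilation_zero, one_mulVec, mul_zero, Real.exp_zero, one_mul, sub_self,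
        sub_zero, smul_eq_mul]
      exact mul_nonneg (inv_nonneg.2 ht.le) (by linarith)
    nlinarith [mul_pos hb hV]
  · intro h
    obtain ⟨b, hb, hle⟩ := exists_pos_mul_form_le (P * G) P h
      fun x hx => dotProduct_mulVec_self_pos hP hx
    refine ⟨b, hb, fun s hs x => ?_⟩
    have hmono : Monotone fun s => Real.exp (-(2 * b * s)) *
        ((dilation G s *ᵥ x) ⬝ᵥ (P *ᵥ (dilation G s *ᵥ x))) := by
      have hd : ∀ s, HasDerivAt (fun s => Real.exp (-(2 * b * s)) *
          ((dilation G s *ᵥ x) ⬝ᵥ (P *ᵥ (dilation G s *ᵥ x))))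
          (Real.exp (-(2 * b * s)) * -(2 * b) *
            ((dilation G s *ᵥ x) ⬝ᵥ (P *ᵥ (dilation G s *ᵥ x))) +
          Real.exp (-(2 * b * s)) *
            (2 * ((dilation G s *ᵥ x) ⬝ᵥ ((P * G) *ᵥ (dilation G s *ᵥ x))))) s := fun s => by
        have h2 : HasDerivAt (fun s : ℝ => Real.exp (-(2 * b * s)))
            (Real.exp (-(2 * b * s)) * -(2 * b)) s := by
          simpa using (((hasDerivAt_id s).const_mul (2 * b)).neg).exp
        exact h2.mul (hasDerivAt_form_dilation hP s x)
      refine monotone_of_deriv_nonneg (fun s => (hd s).differentiableAt) fun s => ?_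
      rw [(hd s).deriv]
      nlinarith [Real.exp_pos (-(2 * b * s)), hle (dilation G s *ᵥ x),
        mul_nonneg (Real.exp_pos (-(2 * b * s))).le (sub_nonneg.2 (hle (dilation G s *ᵥ x)))]
    have h0 := hmono hs
    simp only [dilation_zero, one_mulVec, mul_zero, neg_zero, Real.exp_zero, one_mul] at h0
    have h1 : (dilation G s *ᵥ x) ⬝ᵥ (P *ᵥ (dilation G s *ᵥ x)) ≤
        Real.exp (b * s) ^ 2 * (x ⬝ᵥ (P *ᵥ x)) := by
      have h2 := mul_le_mul_of_nonneg_left h0 (Real.exp_pos (2 * b * s)).le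
      rw [← mul_assoc, ← Real.exp_add, add_neg_cancel, Real.exp_zero, one_mul] at h2
      rwa [← Real.exp_nat_mul, Nat.cast_ofNat, ← mul_assoc]
    calc wnorm P (dilation G s *ᵥ x) ≤ Real.sqrt (Real.exp (b * s) ^ 2 * (x ⬝ᵥ (P *ᵥ x))) :=
          Real.sqrt_le_sqrt h1
      _ = _ := by rw [Real.sqrt_mul (sq_nonneg _), Real.sqrt_sq (Real.exp_pos _).le]; rfl

/-- Along the orbit `s ↦ d(-s)x` of a nonzero point the form `xᵀPx` is strictly decreasing. -/
theorem strictAnti_form_dilation_neg (hP : P.PosDef) (h : IsStrictlyMonotone P G)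
    {x : Fin n → ℝ} (hx : x ≠ 0) :
    StrictAnti fun s => (dilation G (-s) *ᵥ x) ⬝ᵥ (P *ᵥ (dilation G (-s) *ᵥ x)) := by
  have hmono : StrictMono fun s => (dilation G s *ᵥ x) ⬝ᵥ (P *ᵥ (dilation G s *ᵥ x)) :=
    strictMono_of_deriv_pos fun s => by
      rw [(hasDerivAt_form_dilation hP s x).deriv]
      exact mul_pos two_pos ((isStrictlyMonotone_iff hP).1 h _ (dilation_mulVec_ne_zero G s hx))
  exact fun s t hst => hmono (neg_lt_neg hst)

theorem continuous_form_dilation_neg :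
    Continuous fun q : ℝ × (Fin n → ℝ) =>
      (dilation G (-q.1) *ᵥ q.2) ⬝ᵥ (P *ᵥ (dilation G (-q.1) *ᵥ q.2)) :=
  (continuous_form P).comp
    (contDiff_dilation_mulVec G contDiff_fst.neg contDiff_snd).continuous

theorem exists_form_dilation_neg_eq_one (hP : P.PosDef) (h : IsStrictlyMonotone P G)
    {x : Fin n → ℝ} (hx : x ≠ 0) :
    ∃ s : ℝ, (dilation G (-s) *ᵥ x) ⬝ᵥ (P *ᵥ (dilation G (-s) *ᵥ x)) = 1 := by
  obtain ⟨b, hb, h⟩ := h.exists_exp_mul_le hP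
  have hV := dotProduct_mulVec_self_pos hP hx
  have hcont : Continuous fun s : ℝ =>
      (dilation G (-s) *ᵥ x) ⬝ᵥ (P *ᵥ (dilation G (-s) *ᵥ x)) :=
    continuous_form_dilation_neg.comp (continuous_id.prodMk continuous_const)
  have hexp : Filter.Tendsto (fun s : ℝ => Real.exp (2 * b * s)) Filter.atTop Filter.atTop :=
    Real.tendsto_exp_atTop.comp (Filter.tendsto_id.const_mul_atTop (by positivity))
  obtain ⟨s₁, hs₁, hs₁'⟩ := ((hexp.eventually_ge_atTop (1 / (x ⬝ᵥ (P *ᵥ x)))).and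
    (Filter.eventually_ge_atTop 0)).exists
  obtain ⟨s₂, hs₂, hs₂'⟩ := ((hexp.eventually_ge_atTop (x ⬝ᵥ (P *ᵥ x))).and
    (Filter.eventually_ge_atTop 0)).exists
  have h1 : 1 ≤ (dilation G (-(-s₁)) *ᵥ x) ⬝ᵥ (P *ᵥ (dilation G (-(-s₁)) *ᵥ x)) := by
    rw [neg_neg]
    exact ((div_le_iff₀ hV).1 hs₁).trans (h s₁ hs₁' x)
  have h2 : (dilation G (-s₂) *ᵥ x) ⬝ᵥ (P *ᵥ (dilation G (-s₂) *ᵥ x)) ≤ 1 := by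
    have := h s₂ hs₂' (dilation G (-s₂) *ᵥ x)
    rw [dilation_mulVec_mulVec, add_neg_cancel, dilation_zero, one_mulVec] at this
    have h3 := this.trans hs₂
    exact le_of_mul_le_mul_left (by simpa using h3) (Real.exp_pos (2 * b * s₂))
  obtain ⟨s, hs⟩ := mem_range_of_exists_le_of_exists_ge hcont ⟨s₂, h2⟩ ⟨-s₁, h1⟩
  exact ⟨s, hs⟩

theorem homNorm_pos {x : Fin n → ℝ} (hx : x ≠ 0) : 0 < homNorm P G x := by
  rw [homNorm, if_neg hx]; exact Real.exp_pos _

theorem form_dilation_neg_log_homNorm (hP : P.PosDef) (h : IsStrictlyMonotone P G)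
    {x : Fin n → ℝ} (hx : x ≠ 0) :
    (dilation G (-Real.log (homNorm P G x)) *ᵥ x) ⬝ᵥ
      (P *ᵥ (dilation G (-Real.log (homNorm P G x)) *ᵥ x)) = 1 := by
  rw [homNorm, if_neg hx, Real.log_exp, ← wnorm_eq_one_iff]
  have := exists_form_dilation_neg_eq_one hP h hx
  simp only [← wnorm_eq_one_iff] at this
  exact Classical.epsilon_spec this

theorem lt_log_homNorm_iff (hP : P.PosDef) (h : IsStrictlyMonotone P G)
    {x : Fin n → ℝ} (hx : x ≠ 0) (s : ℝ) :
    s < Real.log (homNorm P G x) ↔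
      1 < (dilation G (-s) *ᵥ x) ⬝ᵥ (P *ᵥ (dilation G (-s) *ᵥ x)) := by
  rw [← form_dilation_neg_log_homNorm hP h hx]
  exact ((strictAnti_form_dilation_neg hP h hx).lt_iff_gt).symm

theorem log_homNorm_lt_iff (hP : P.PosDef) (h : IsStrictlyMonotone P G)
    {x : Fin n → ℝ} (hx : x ≠ 0) (s : ℝ) :
    Real.log (homNorm P G x) < s ↔
      (dilation G (-s) *ᵥ x) ⬝ᵥ (P *ᵥ (dilation G (-s) *ᵥ x)) < 1 := by
  rw [← form_dilation_neg_log_homNorm hP h hx]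
  exact ((strictAnti_form_dilation_neg hP h hx).lt_iff_gt).symm

theorem log_homNorm_eq (hP : P.PosDef) (h : IsStrictlyMonotone P G)
    {x : Fin n → ℝ} (hx : x ≠ 0) {s : ℝ}
    (hs : (dilation G (-s) *ᵥ x) ⬝ᵥ (P *ᵥ (dilation G (-s) *ᵥ x)) = 1) :
    Real.log (homNorm P G x) = s :=
  (strictAnti_form_dilation_neg hP h hx).injective
    ((form_dilation_neg_log_homNorm hP h hx).trans hs.symm)

/-- The homogeneous ellipsoid is, as a set, the ordinary ellipsoid `xᵀPx ≤ 1`. -/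
theorem mem_homEllipsoid_iff (hP : P.PosDef) (h : IsStrictlyMonotone P G) (x : Fin n → ℝ) :
    x ∈ homEllipsoid P G ↔ x ⬝ᵥ (P *ᵥ x) ≤ 1 := by
  by_cases hx : x = 0
  · simp [homEllipsoid, homNorm, hx]
  have h1 := lt_log_homNorm_iff hP h hx 0
  rw [neg_zero, dilation_zero, one_mulVec] at h1
  rw [homEllipsoid, mem_ofPred_eq, ← Real.log_nonpos_iff (homNorm_pos hx).le, ← not_lt, h1, not_lt]

theorem continuousAt_log_homNorm (hP : P.PosDef) (h : IsStrictlyMonotone P G)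
    {x : Fin n → ℝ} (hx : x ≠ 0) :
    ContinuousAt (fun x => Real.log (homNorm P G x)) x := by
  have hc : ∀ s, Continuous fun y : Fin n → ℝ =>
      (dilation G (-s) *ᵥ y) ⬝ᵥ (P *ᵥ (dilation G (-s) *ᵥ y)) := fun s =>
    continuous_form_dilation_neg.comp (continuous_const.prodMk continuous_id)
  refine tendsto_order.2 ⟨fun s hs => ?_, fun s hs => ?_⟩
  · filter_upwards [(hc s).continuousAt.eventually_const_lt ((lt_log_homNorm_iff hP h hx s).1 hs),
      isOpen_ne.mem_nhds hx] with y hy hy0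
    exact (lt_log_homNorm_iff hP h hy0 s).2 hy
  · filter_upwards [(hc s).continuousAt.eventually_lt_const ((log_homNorm_lt_iff hP h hx s).1 hs),
      isOpen_ne.mem_nhds hx] with y hy hy0
    exact (log_homNorm_lt_iff hP h hy0 s).2 hy

end Monotone

/-! ### The S-procedure -/

/-- A concave quadratic that is positive at `0` has a negative and a positive root; their product
is `a / c`. -/
theorem exists_roots_of_pos_of_neg {a b c : ℝ} (ha : 0 < a) (hc : c < 0) :
    ∃ t₁ t₂ : ℝ, t₁ < 0 ∧ 0 < t₂ ∧ a + b * t₁ + c * t₁ ^ 2 = 0 ∧ a + b * t₂ + c * t₂ ^ 2 = 0 ∧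
      c * (t₁ * t₂) = a := by
  have hd : b ^ 2 < b ^ 2 - 4 * a * c := by nlinarith
  have hr := Real.sq_sqrt ((sq_nonneg b).trans hd.le)
  have habs : |b| < Real.sqrt (b ^ 2 - 4 * a * c) := by
    rw [← Real.sqrt_sq_eq_abs]; exact Real.sqrt_lt_sqrt (sq_nonneg b) hd
  set r := Real.sqrt (b ^ 2 - 4 * a * c)
  obtain ⟨h1, h2⟩ := abs_lt.1 habs
  have hc0 : c ≠ 0 := hc.ne
  refine ⟨(-b + r) / (2 * c), (-b - r) / (2 * c), div_neg_of_pos_of_neg (by linarith) (by linarith),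
    div_pos_of_neg_of_neg (by linarith) (by linarith), ?_, ?_, ?_⟩
  · field_simp
    linear_combination hr
  · field_simp
    linear_combination hr
  · field_simp
    linear_combination -hr

theorem form_add_smul {ι : Type*} [Fintype ι] (M : Matrix ι ι ℝ) (z w : ι → ℝ) (t : ℝ) :
    (z + t • w) ⬝ᵥ (M *ᵥ (z + t • w)) =
      z ⬝ᵥ (M *ᵥ z) + (z ⬝ᵥ (M *ᵥ w) + w ⬝ᵥ (M *ᵥ z)) * t + (w ⬝ᵥ (M *ᵥ w)) * t ^ 2 := by
  simp only [mulVec_add, mulVec_smul, dotProduct_add, add_dotProduct, smul_dotProduct,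
    dotProduct_smul, smul_eq_mul]
  ring

/-- The two-point form of the S-procedure. On the line through `z` in direction `w` the form of `N`
vanishes at two parameters of opposite sign; the convex combination of the two resulting
inequalities that cancels the cross term is the claim. -/
theorem form_mul_form_le {ι : Type*} [Fintype ι] {M N : Matrix ι ι ℝ}
    (h : ∀ z, 0 ≤ z ⬝ᵥ (N *ᵥ z) → z ⬝ᵥ (M *ᵥ z) ≤ 0) {z w : ι → ℝ}
    (hz : 0 < z ⬝ᵥ (N *ᵥ z)) (hw : w ⬝ᵥ (N *ᵥ w) < 0) :
    (w ⬝ᵥ (M *ᵥ w)) * (z ⬝ᵥ (N *ᵥ z)) ≤ (z ⬝ᵥ (M *ᵥ z)) * (w ⬝ᵥ (N *ᵥ w)) := by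
  obtain ⟨t₁, t₂, ht₁, ht₂, h₁, h₂, hprod⟩ :=
    exists_roots_of_pos_of_neg (b := z ⬝ᵥ (N *ᵥ w) + w ⬝ᵥ (N *ᵥ z)) hz hw
  have e₁ := h (z + t₁ • w) (by rw [form_add_smul, h₁])
  have e₂ := h (z + t₂ • w) (by rw [form_add_smul, h₂])
  rw [form_add_smul] at e₁ e₂
  have key : (z ⬝ᵥ (M *ᵥ z) - t₁ * t₂ * (w ⬝ᵥ (M *ᵥ w))) * (t₂ - t₁) ≤ 0 := by
    nlinarith [mul_nonpos_of_nonneg_of_nonpos ht₂.le e₁,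
      mul_nonpos_of_nonneg_of_nonpos (neg_nonneg.2 ht₁.le) e₂]
  have key' : z ⬝ᵥ (M *ᵥ z) - t₁ * t₂ * (w ⬝ᵥ (M *ᵥ w)) ≤ 0 :=
    nonpos_of_mul_nonpos_left key (by linarith)
  rw [← hprod]
  nlinarith [mul_nonneg_of_nonpos_of_nonpos key' hw.le]

/-- The lossless S-procedure for two homogeneous quadratic forms. -/
theorem exists_multiplier {ι : Type*} [Fintype ι] {M N : Matrix ι ι ℝ}
    (h : ∀ z, 0 ≤ z ⬝ᵥ (N *ᵥ z) → z ⬝ᵥ (M *ᵥ z) ≤ 0) (hN : ∃ z, 0 < z ⬝ᵥ (N *ᵥ z)) :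
    ∃ β : ℝ, 0 ≤ β ∧ ∀ z, z ⬝ᵥ (M *ᵥ z) + β * (z ⬝ᵥ (N *ᵥ z)) ≤ 0 := by
  set S : Set ℝ := (fun z : ι → ℝ => -(z ⬝ᵥ (M *ᵥ z)) / (z ⬝ᵥ (N *ᵥ z))) ''
    {z | 0 < z ⬝ᵥ (N *ᵥ z)}
  have hS : S.Nonempty := Set.Nonempty.image _ hN
  have h0 : ∀ r ∈ S, 0 ≤ r := by
    rintro _ ⟨z, hz, rfl⟩
    exact div_nonneg (neg_nonneg.2 (h z (le_of_lt hz))) (le_of_lt hz)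
  refine ⟨sInf S, le_csInf hS h0, fun w => ?_⟩
  rcases lt_trichotomy (w ⬝ᵥ (N *ᵥ w)) 0 with hw | hw | hw
  · have : (w ⬝ᵥ (M *ᵥ w)) / -(w ⬝ᵥ (N *ᵥ w)) ≤ sInf S := by
      refine le_csInf hS ?_
      rintro _ ⟨z, hz, rfl⟩
      have hz : 0 < z ⬝ᵥ (N *ᵥ z) := hz
      rw [div_le_div_iff₀ (neg_pos.2 hw) hz]
      linarith [form_mul_form_le h hz hw]
    rw [div_le_iff₀ (neg_pos.2 hw)] at this
    linarith
  · rw [hw, mul_zero, add_zero]; exact h w hw.ge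
  · have : sInf S ≤ _ := csInf_le ⟨0, h0⟩ ⟨w, hw, rfl⟩
    rw [le_div_iff₀ hw] at this
    linarith

/-! ### The matrix inequalities as inequalities between quadratic forms -/

section MatrixInequalities

variable {n m p : ℕ} {X : Matrix (Fin n) (Fin n) ℝ} {Q : Matrix (Fin p) (Fin p) ℝ}

theorem isUnit_det_of_posDef {ι : Type*} [Fintype ι] [DecidableEq ι] {M : Matrix ι ι ℝ}
    (hM : M.PosDef) : IsUnit M.det := hM.det_pos.ne'.isUnit

theorem posDef_of_posDef_inv (hP : X⁻¹.PosDef) : X.PosDef := by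
  have h := hP.inv
  rwa [nonsing_inv_nonsing_inv _ (isUnit_nonsing_inv_det_iff.1 (isUnit_det_of_posDef hP))] at h

theorem dotProduct_mulVec_transpose {k l : Type*} [Fintype k] [Fintype l] (M : Matrix k l ℝ)
    (x : l → ℝ) (y : k → ℝ) : x ⬝ᵥ (Mᵀ *ᵥ y) = y ⬝ᵥ (M *ᵥ x) := by
  rw [mulVec_transpose, dotProduct_comm, dotProduct_mulVec]

theorem mulVec_dotProduct_inv_mulVec (hX : X.PosDef) (ξ y : Fin n → ℝ) :
    (X *ᵥ ξ) ⬝ᵥ (X⁻¹ *ᵥ y) = ξ ⬝ᵥ y := by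
  rw [dotProduct_mulVec_comm_of_posDef hX.inv, mulVec_mulVec,
    nonsing_inv_mul _ (isUnit_det_of_posDef hX), one_mulVec, dotProduct_comm]

/-- The Lyapunov inequality `GX + XGᵀ ≻ 0` in terms of `P = X⁻¹`, by the congruence `x = Xξ`. -/
theorem posDef_mul_add_mul_transpose_iff (hX : X.PosDef) (G : Matrix (Fin n) (Fin n) ℝ) :
    (G * X + X * Gᵀ).PosDef ↔ ∀ x : Fin n → ℝ, x ≠ 0 → 0 < x ⬝ᵥ ((X⁻¹ * G) *ᵥ x) := by
  have hu := isUnit_det_of_posDef hX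
  have hform : ∀ ξ : Fin n → ℝ, ξ ⬝ᵥ ((G * X + X * Gᵀ) *ᵥ ξ) =
      2 * ((X *ᵥ ξ) ⬝ᵥ ((X⁻¹ * G) *ᵥ (X *ᵥ ξ))) := fun ξ => by
    have h1 : (X * Gᵀ) = (G * X)ᵀ := by rw [transpose_mul, transpose_eq_of_posDef hX]
    have h2 : (X *ᵥ ξ) ⬝ᵥ ((X⁻¹ * G) *ᵥ (X *ᵥ ξ)) = ξ ⬝ᵥ ((G * X) *ᵥ ξ) := by
      rw [← mulVec_mulVec, mulVec_dotProduct_inv_mulVec hX, mulVec_mulVec]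
    rw [h1, add_mulVec, dotProduct_add, dotProduct_mulVec_transpose, h2]
    ring
  rw [posDef_iff_dotProduct_mulVec]
  constructor
  · rintro ⟨-, h⟩ x hx
    have hx' : X *ᵥ (X⁻¹ *ᵥ x) = x := by rw [mulVec_mulVec, mul_nonsing_inv _ hu, one_mulVec]
    have := h (x := X⁻¹ *ᵥ x) fun h0 => hx (by rw [← hx', h0, mulVec_zero])
    rw [star_trivial, hform, hx'] at this
    linarith
  · intro h
    refine ⟨?_, fun ξ hξ => ?_⟩
    · rw [IsHermitian, conjTranspose_eq_transpose_of_trivial, transpose_add, transpose_mul,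
        transpose_mul, transpose_transpose, transpose_eq_of_posDef hX, add_comm]
    · rw [star_trivial, hform]
      refine mul_pos two_pos (h _ fun h0 => hξ ?_)
      rw [← one_mulVec ξ, ← nonsing_inv_mul _ hu, ← mulVec_mulVec, h0, mulVec_zero]

variable (A₀ : Matrix (Fin n) (Fin n) ℝ) (B : Matrix (Fin n) (Fin m) ℝ)
  (D : Matrix (Fin n) (Fin p) ℝ) (K : Matrix (Fin m) (Fin n) ℝ)

theorem form_matW (hX : X.PosDef) (β : ℝ) (ξ : Fin n → ℝ) (w : Fin p → ℝ) :
    Sum.elim ξ w ⬝ᵥ (matW A₀ B D Q X (K * X) β *ᵥ Sum.elim ξ w) =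
      2 * ((X *ᵥ ξ) ⬝ᵥ (X⁻¹ *ᵥ (A₀ *ᵥ (X *ᵥ ξ) + (B * K) *ᵥ (X *ᵥ ξ) + D *ᵥ w))) +
        β * ((X *ᵥ ξ) ⬝ᵥ (X⁻¹ *ᵥ (X *ᵥ ξ)) - w ⬝ᵥ (Q *ᵥ w)) := by
  have h1 : A₀ * X + X * A₀ᵀ + B * (K * X) + (K * X)ᵀ * Bᵀ + β • X =
      ((A₀ * X + B * K * X) + (A₀ * X + B * K * X)ᵀ) + β • X := by
    simp only [transpose_add, transpose_mul, transpose_eq_of_posDef hX, Matrix.mul_assoc]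
    abel
  rw [matW, fromBlocks_mulVec, sumElim_dotProduct_sumElim, h1, mulVec_dotProduct_inv_mulVec hX,
    mulVec_dotProduct_inv_mulVec hX]
  simp only [Sum.elim_comp_inl, Sum.elim_comp_inr, add_mulVec, dotProduct_add,
    dotProduct_mulVec_transpose, neg_mulVec, smul_mulVec, dotProduct_smul, dotProduct_neg,
    smul_eq_mul, mulVec_mulVec]
  ring

theorem posSemidef_neg_matW_iff (hX : X.PosDef) (hQ : Q.PosDef) (β : ℝ) :
    (-(matW A₀ B D Q X (K * X) β)).PosSemidef ↔ ∀ (x : Fin n → ℝ) (w : Fin p → ℝ),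
      2 * (x ⬝ᵥ (X⁻¹ *ᵥ (A₀ *ᵥ x + (B * K) *ᵥ x + D *ᵥ w))) ≤
        β * (w ⬝ᵥ (Q *ᵥ w) - x ⬝ᵥ (X⁻¹ *ᵥ x)) := by
  have hu := isUnit_det_of_posDef hX
  rw [posSemidef_iff_dotProduct_mulVec]
  constructor
  · rintro ⟨-, h⟩ x w
    have := h (Sum.elim (X⁻¹ *ᵥ x) w)
    rw [star_trivial, neg_mulVec, dotProduct_neg, form_matW _ _ _ _ hX, mulVec_mulVec x X X⁻¹,
      mul_nonsing_inv _ hu, one_mulVec] at this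
    linarith
  · intro h
    refine ⟨?_, fun z => ?_⟩
    · refine IsHermitian.neg (IsHermitian.fromBlocks ?_ ?_ ?_)
      · rw [IsHermitian, conjTranspose_eq_transpose_of_trivial]
        simp only [transpose_add, transpose_mul, transpose_smul, transpose_transpose,
          transpose_eq_of_posDef hX]
        abel
      · exact conjTranspose_eq_transpose_of_trivial D
      · rw [IsHermitian, conjTranspose_eq_transpose_of_trivial, transpose_neg, transpose_smul,
          transpose_eq_of_posDef hQ]
    · have := h (X *ᵥ (z ∘ Sum.inl)) (z ∘ Sum.inr)
      rw [← Sum.elim_comp_inl_inr z, star_trivial, neg_mulVec, dotProduct_neg,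
        form_matW _ _ _ _ hX]
      linarith

/-- The S-procedure turns inward-pointing velocities on the boundary of the ellipsoid `xᵀX⁻¹x ≤ 1`
into the matrix inequality. The multiplier is not zero because `D ≠ 0`. -/
theorem exists_posSemidef_neg_matW (hD : D ≠ 0) (hX : X.PosDef) (hQ : Q.PosDef)
    (h : ∀ (x : Fin n → ℝ) (w : Fin p → ℝ), x ⬝ᵥ (X⁻¹ *ᵥ x) = 1 → w ⬝ᵥ (Q *ᵥ w) ≤ 1 →
      x ⬝ᵥ (X⁻¹ *ᵥ (A₀ *ᵥ x + (B * K) *ᵥ x + D *ᵥ w)) ≤ 0) :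
    ∃ β : ℝ, 0 < β ∧ (-(matW A₀ B D Q X (K * X) β)).PosSemidef := by
  have hu := isUnit_det_of_posDef hX
  obtain ⟨i, j, hij⟩ : ∃ i j, D i j ≠ 0 := by
    by_contra! h0; exact hD (Matrix.ext h0)
  -- By homogeneity the normalization `xᵀX⁻¹x = 1` can be dropped.
  have hcone : ∀ (x : Fin n → ℝ) (w : Fin p → ℝ), w ⬝ᵥ (Q *ᵥ w) ≤ x ⬝ᵥ (X⁻¹ *ᵥ x) →
      x ⬝ᵥ (X⁻¹ *ᵥ (A₀ *ᵥ x + (B * K) *ᵥ x + D *ᵥ w)) ≤ 0 := by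
    intro x w hxw
    by_cases hx : x = 0
    · simp [hx]
    have hV := dotProduct_mulVec_self_pos hX.inv hx
    set c := (Real.sqrt (x ⬝ᵥ (X⁻¹ *ᵥ x)))⁻¹ with hc
    have hc0 : 0 < c := inv_pos.2 (Real.sqrt_pos.2 hV)
    have hc2 : c ^ 2 * (x ⬝ᵥ (X⁻¹ *ᵥ x)) = 1 := by
      rw [hc, inv_pow, Real.sq_sqrt hV.le, inv_mul_cancel₀ hV.ne']
    have := h (c • x) (c • w) (by rw [smul_form, hc2]) (by
      rw [smul_form, ← hc2]; gcongr)
    simp only [mulVec_smul, ← smul_add, dotProduct_smul, smul_dotProduct, smul_eq_mul] at this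
    exact nonpos_of_mul_nonpos_right (nonpos_of_mul_nonpos_right this hc0) hc0
  have hWform : ∀ (β : ℝ) (z : Fin n ⊕ Fin p → ℝ),
      z ⬝ᵥ (matW A₀ B D Q X (K * X) β *ᵥ z) = z ⬝ᵥ (matW A₀ B D Q X (K * X) 0 *ᵥ z) +
        β * (z ⬝ᵥ (fromBlocks X 0 0 (-Q) *ᵥ z)) := by
    intro β z
    rw [← smul_eq_mul, ← dotProduct_smul, ← dotProduct_add, ← smul_mulVec, ← add_mulVec]
    congr 2
    simp [matW, fromBlocks_smul, fromBlocks_add]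
  have hNform : ∀ z : Fin n ⊕ Fin p → ℝ, z ⬝ᵥ (fromBlocks X 0 0 (-Q) *ᵥ z) =
      (z ∘ Sum.inl) ⬝ᵥ (X *ᵥ (z ∘ Sum.inl)) - (z ∘ Sum.inr) ⬝ᵥ (Q *ᵥ (z ∘ Sum.inr)) := by
    intro z
    conv_lhs => rw [← Sum.elim_comp_inl_inr z]
    rw [fromBlocks_mulVec, sumElim_dotProduct_sumElim]
    simp [neg_mulVec, sub_eq_add_neg]
  obtain ⟨β, hβ, hle⟩ := exists_multiplier (M := matW A₀ B D Q X (K * X) 0)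
    (N := fromBlocks X 0 0 (-Q)) (by
      intro z hz
      rw [hNform] at hz
      rw [← Sum.elim_comp_inl_inr z, form_matW _ _ _ _ hX, zero_mul, add_zero]
      refine mul_nonpos_of_nonneg_of_nonpos two_pos.le (hcone _ _ ?_)
      rw [mulVec_dotProduct_inv_mulVec hX]
      linarith)
    ⟨Sum.elim (Pi.single i 1) 0, by
      rw [hNform, Sum.elim_comp_inl, Sum.elim_comp_inr]
      simpa using! dotProduct_mulVec_self_pos hX (x := Pi.single i (1 : ℝ)) (by simp)⟩
  have hpsd := (posSemidef_neg_matW_iff A₀ B D K hX hQ β).1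
  have hpsd' : (-(matW A₀ B D Q X (K * X) β)).PosSemidef := by
    rw [posSemidef_neg_matW_iff A₀ B D K hX hQ β]
    intro x w
    have := hle (Sum.elim (X⁻¹ *ᵥ x) w)
    rw [← hWform, form_matW _ _ _ _ hX, mulVec_mulVec x X X⁻¹,
      mul_nonsing_inv _ hu, one_mulVec] at this
    linarith
  refine ⟨β, hβ.lt_of_ne fun h0 => ?_, hpsd'⟩
  -- For `β = 0` the left-hand side is affine and bounded above in `w`. With `x = X eᵢ` its linear
  -- part contains `D i j ≠ 0`, and `w` is chosen such that its value is `2`.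
  set x := X *ᵥ Pi.single i (1 : ℝ) with hx
  have hlin := hpsd hpsd' x (((1 - (A₀ *ᵥ x + (B * K) *ᵥ x) i) / D i j) • Pi.single j 1)
  rw [← h0, zero_mul, hx, mulVec_dotProduct_inv_mulVec hX, ← hx] at hlin
  simp only [single_one_dotProduct, Pi.add_apply, mulVec_smul, Pi.smul_apply, smul_eq_mul,
    mulVec_single_one, col_apply, div_mul_cancel₀ _ hij] at hlin
  linarith

end MatrixInequalities

/-! ### Filippov sets and absolutely continuous functions -/

/-- At a point of continuity the Filippov set is the singleton of the value. -/
theorem filippov_eq_of_continuousAt {n : ℕ} {g : (Fin n → ℝ) → (Fin n → ℝ)} {x : Fin n → ℝ}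
    (hg : ContinuousAt g x) : filippov g x = {g x} := by
  refine Subset.antisymm (fun v hv => ?_) (singleton_subset_iff.2 ?_)
  · simp only [filippov, mem_iInter] at hv
    refine eq_of_forall_dist_le fun ε hε => ?_
    obtain ⟨δ, hδ, h⟩ := Metric.continuousAt_iff.1 hg ε hε
    have hsub : closure (convexHull ℝ (g '' (Metric.ball x δ \ ∅))) ⊆ Metric.closedBall (g x) ε := by
      refine closure_minimal (convexHull_min ?_ (convex_closedBall _ _)) Metric.isClosed_closedBall
      rintro _ ⟨y, hy, rfl⟩
      exact (h hy.1).le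
    exact hsub (hv δ hδ ∅ measure_empty)
  · simp only [filippov, mem_iInter]
    intro δ hδ N hN
    refine closure_mono (subset_convexHull ℝ _) (Metric.mem_closure_iff.2 fun ε hε => ?_)
    obtain ⟨δ', hδ', h⟩ := Metric.continuousAt_iff.1 hg ε hε
    -- The null set `N` cannot contain a ball around `x`.
    have hpos : volume (Metric.ball x (min δ δ') \ N) ≠ 0 := by
      rw [measure_sdiff_null hN]
      exact (Metric.measure_ball_pos volume x (lt_min hδ hδ')).ne'
    obtain ⟨y, hy, hyN⟩ := nonempty_of_measure_ne_zero hpos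
    have hy' : dist y x < min δ δ' := hy
    exact ⟨g y, ⟨y, ⟨hy'.trans_le (min_le_left _ _), hyN⟩, rfl⟩,
      by rw [dist_comm]; exact h (hy'.trans_le (min_le_right _ _))⟩

theorem _root_.AbsolutelyContinuousOnInterval.comp_lipschitzOnWith {X Y : Type*}
    [PseudoMetricSpace X] [PseudoMetricSpace Y] {f : ℝ → X} {a b : ℝ} {φ : X → Y} {K : NNReal}
    (hf : AbsolutelyContinuousOnInterval f a b) (hφ : LipschitzOnWith K φ (f '' uIcc a b)) :
    AbsolutelyContinuousOnInterval (fun t => φ (f t)) a b := by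
  rw [absolutelyContinuousOnInterval_iff] at hf ⊢
  intro ε hε
  obtain ⟨δ, hδ, h⟩ := hf (ε / (K + 1)) (by positivity)
  refine ⟨δ, hδ, fun E hE hlt => ?_⟩
  have h1 := h E hE hlt
  calc _ ≤ ∑ i ∈ Finset.range E.1, K * dist (f (E.2 i).1) (f (E.2 i).2) :=
        Finset.sum_le_sum fun i hi => hφ.dist_le_mul _ (mem_image_of_mem f (hE.1 i hi).1) _
          (mem_image_of_mem f (hE.1 i hi).2)
    _ = K * ∑ i ∈ Finset.range E.1, dist (f (E.2 i).1) (f (E.2 i).2) := by rw [Finset.mul_sum]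
    _ ≤ K * (ε / (K + 1)) := by gcongr
    _ < (K + 1) * (ε / (K + 1)) := by gcongr; linarith
    _ = ε := by field

/-- An absolutely continuous function is absolutely continuous after composition with a `C¹`
function. -/
theorem _root_.AbsolutelyContinuousOnInterval.comp_contDiff {E F : Type*} [NormedAddCommGroup E]
    [NormedSpace ℝ E] [NormedAddCommGroup F] [NormedSpace ℝ F] {f : ℝ → E} {a b : ℝ} {φ : E → F}
    (hf : AbsolutelyContinuousOnInterval f a b) (hφ : ContDiff ℝ 1 φ) :
    AbsolutelyContinuousOnInterval (fun t => φ (f t)) a b := by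
  obtain ⟨K, hK⟩ := (locallyLipschitzOn_univ.2 hφ.locallyLipschitz |>.mono
    (subset_univ _)).exists_lipschitzOnWith_of_compact
      (isCompact_uIcc.image_of_continuousOn hf.continuousOn)
  exact hf.comp_lipschitzOnWith hK

/-- A barrier principle: an absolutely continuous function that starts nonpositive and whose
derivative is at most `C w` wherever its value `w` is small and positive stays nonpositive. -/
theorem nonpos_of_ae_deriv_le_mul {w : ℝ → ℝ} {T C r : ℝ} (hr : 0 < r)
    (hw : AbsolutelyContinuousOnInterval w 0 T) (h0 : w 0 ≤ 0)
    (hd : ∀ᵐ t ∂(volume.restrict (Ioo (0 : ℝ) T)), 0 < w t → w t < r →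
      ∃ w', HasDerivAt w w' t ∧ w' ≤ C * w t) :
    ∀ t ∈ Icc 0 T, w t ≤ 0 := by
  intro t₁ ht₁
  by_contra! hpos
  have hcont : ContinuousOn w (Icc 0 T) := by
    simpa [uIcc_of_le (ht₁.1.trans ht₁.2)] using hw.continuousOn
  -- `t₀` is the last time before `t₁` at which `w ≤ 0`.
  set S : Set ℝ := {t ∈ Icc 0 t₁ | w t ≤ 0} with hS
  have hScomp : IsCompact S := by
    have : S = Icc 0 t₁ ∩ w ⁻¹' Iic 0 := rfl
    rw [this]
    exact isCompact_Icc.of_isClosed_subset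
      ((hcont.mono (Icc_subset_Icc_right ht₁.2)).preimage_isClosed_of_isClosed isClosed_Icc
        isClosed_Iic) inter_subset_left
  obtain ⟨t₀, ht₀, hmax⟩ := hScomp.exists_isGreatest ⟨0, ⟨le_rfl, ht₁.1⟩, h0⟩
  have ht₀₁ : t₀ < t₁ := lt_of_le_of_ne ht₀.1.2 fun h => by
    rw [h] at ht₀; exact absurd ht₀.2 hpos.not_ge
  have hafter : ∀ t, t₀ < t → t ≤ t₁ → 0 < w t := fun t h1 h2 => by
    by_contra! h3
    exact absurd (hmax ⟨⟨ht₀.1.1.trans h1.le, h2⟩, h3⟩) h1.not_ge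
  -- Shortly after `t₀` the values are still below `r`.
  have hev : ∀ᶠ t in nhdsWithin t₀ (Icc 0 T), w t < r :=
    (hcont t₀ ⟨ht₀.1.1, ht₀.1.2.trans ht₁.2⟩).eventually_lt_const (ht₀.2.trans_lt hr)
  obtain ⟨ε, hε, hball⟩ := Metric.mem_nhdsWithin_iff.1 hev
  set t₂ := min t₁ (t₀ + ε / 2)
  have ht₀₂ : t₀ < t₂ := lt_min ht₀₁ (by linarith)
  have ht₂₁ : t₂ ≤ t₁ := min_le_left _ _
  have hsmall : ∀ t ∈ Ioc t₀ t₂, w t < r := fun t ht => hball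
    ⟨by
      have h2 : t₂ ≤ t₀ + ε / 2 := min_le_right _ _
      rw [Metric.mem_ball, Real.dist_eq, abs_of_pos (sub_pos.2 ht.1)]
      linarith [ht.2],
    ht₀.1.1.trans ht.1.le, ht.2.trans (ht₂₁.trans ht₁.2)⟩
  -- The function `e^{-Ct} w` is absolutely continuous and nonincreasing on `[t₀, t₂]`.
  have hφ : AbsolutelyContinuousOnInterval (fun t => Real.exp (-C * t) * w t) t₀ t₂ := by
    refine AbsolutelyContinuousOnInterval.fun_mul ?_ (hw.mono ?_)
    · exact ContDiffOn.absolutelyContinuousOnInterval (by fun_prop)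
    · rw [uIcc_of_le ht₀₂.le, uIcc_of_le (ht₁.1.trans ht₁.2)]
      exact Icc_subset_Icc ht₀.1.1 (ht₂₁.trans ht₁.2)
  have hint := hφ.integral_deriv_eq_sub
  have hle : ∫ t in t₀..t₂, deriv (fun t => Real.exp (-C * t) * w t) t ≤ 0 := by
    rw [intervalIntegral.integral_of_le ht₀₂.le, integral_Ioc_eq_integral_Ioo]
    refine integral_nonpos_of_ae ?_
    have hd' : ∀ᵐ t ∂(volume.restrict (Ioo t₀ t₂)), 0 < w t → w t < r →
        ∃ w', HasDerivAt w w' t ∧ w' ≤ C * w t :=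
      ae_restrict_of_ae_restrict_of_subset (Ioo_subset_Ioo ht₀.1.1 (ht₂₁.trans ht₁.2)) hd
    filter_upwards [hd', ae_restrict_mem measurableSet_Ioo] with t ht hmem
    obtain ⟨w', hw', hle⟩ := ht (hafter t hmem.1 (hmem.2.le.trans ht₂₁))
      (hsmall t ⟨hmem.1, hmem.2.le⟩)
    have h1 : HasDerivAt (fun t => Real.exp (-C * t)) (Real.exp (-C * t) * -C) t := by
      simpa using ((hasDerivAt_id t).const_mul (-C)).exp
    rw [(h1.fun_mul hw').deriv, Pi.zero_apply]
    nlinarith [mul_nonneg (Real.exp_pos (-C * t)).le (sub_nonneg.2 hle)]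
  have h2 := mul_pos (Real.exp_pos (-C * t₂)) (hafter t₂ ht₀₂ ht₂₁)
  have h3 := mul_nonpos_of_nonneg_of_nonpos (Real.exp_pos (-C * t₀)).le ht₀.2
  linarith

/-! ### The closed loop along the level sets of the homogeneous norm -/

section Slice

variable {n p : ℕ}

/-- The closed-loop field with the logarithm of the homogeneous norm replaced by a free parameter
`s`. It is smooth in `(s, x)`, and the closed loop is its restriction to `s = ln ‖x‖_{d,P}`. -/
def sliceField (A₀ C : Matrix (Fin n) (Fin n) ℝ) (D : Matrix (Fin n) (Fin p) ℝ)
    (G : Matrix (Fin n) (Fin n) ℝ) (μ s : ℝ) (x : Fin n → ℝ) (w : Fin p → ℝ) : Fin n → ℝ :=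
  A₀ *ᵥ x + Real.exp ((μ + 1) * s) • (C *ᵥ (dilation G (-s) *ᵥ x)) + D *ᵥ w

theorem closedLoop_controller_eq {m : ℕ} (A : Matrix (Fin n) (Fin n) ℝ)
    (B : Matrix (Fin n) (Fin m) ℝ) (D : Matrix (Fin n) (Fin p) ℝ) (G₀ : Matrix (Fin n) (Fin n) ℝ)
    (Y₀ K : Matrix (Fin m) (Fin n) ℝ) (X : Matrix (Fin n) (Fin n) ℝ) (μ : ℝ) {x : Fin n → ℝ}
    (hx : x ≠ 0) (w : Fin p → ℝ) :
    closedLoop A B D (controller G₀ Y₀ K X μ) x w =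
      sliceField (matA₀ A B G₀ Y₀) (B * K) D (genG G₀ μ) μ
        (Real.log (homNorm X⁻¹ (genG G₀ μ) x)) x w := by
  have h : homNorm X⁻¹ (genG G₀ μ) x ^ (μ + 1) =
      Real.exp ((μ + 1) * Real.log (homNorm X⁻¹ (genG G₀ μ) x)) := by
    rw [Real.rpow_def_of_pos (homNorm_pos hx), mul_comm]
  rw [closedLoop, controller, sliceField, matA₀, gainK₀, h, mulVec_add, mulVec_smul, add_mulVec,
    mulVec_mulVec, mulVec_mulVec _ B K, ← add_assoc]

variable (A₀ C : Matrix (Fin n) (Fin n) ℝ) (D : Matrix (Fin n) (Fin p) ℝ)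
  (G : Matrix (Fin n) (Fin n) ℝ) (μ : ℝ)

theorem sliceField_zero (x : Fin n → ℝ) (w : Fin p → ℝ) :
    sliceField A₀ C D G μ 0 x w = A₀ *ᵥ x + C *ᵥ x + D *ᵥ w := by
  simp [sliceField]

theorem contDiff_sliceField {E : Type*} [NormedAddCommGroup E] [NormedSpace ℝ E]
    {s : E → ℝ} {x : E → Fin n → ℝ} {w : E → Fin p → ℝ} (hs : ContDiff ℝ 1 s)
    (hx : ContDiff ℝ 1 x) (hw : ContDiff ℝ 1 w) :
    ContDiff ℝ 1 fun e => sliceField A₀ C D G μ (s e) (x e) (w e) :=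
  ((contDiff_const_mulVec A₀ hx).add ((contDiff_const.mul hs).exp.smul
    (contDiff_const_mulVec C (contDiff_dilation_mulVec G hs.neg hx)))).add
    (contDiff_const_mulVec D hw)

variable {A₀ C D G μ} {P : Matrix (Fin n) (Fin n) ℝ} {Q : Matrix (Fin p) (Fin p) ℝ}
  {g : (Fin n → ℝ) → (Fin p → ℝ) → Fin n → ℝ}

theorem filippov_sliceField (hP : P.PosDef) (h : IsStrictlyMonotone P G)
    (hg : ∀ x, x ≠ 0 → ∀ w, g x w = sliceField A₀ C D G μ (Real.log (homNorm P G x)) x w)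
    {x : Fin n → ℝ} (hx : x ≠ 0) (w : Fin p → ℝ) : filippov (fun y => g y w) x = {g x w} := by
  refine filippov_eq_of_continuousAt ?_
  have hc : Continuous fun q : ℝ × (Fin n → ℝ) => sliceField A₀ C D G μ q.1 q.2 w :=
    (contDiff_sliceField A₀ C D G μ contDiff_fst contDiff_snd contDiff_const).continuous
  have h1 : ContinuousAt (fun y => sliceField A₀ C D G μ (Real.log (homNorm P G y)) y w) x :=
    hc.continuousAt.comp (f := fun y => (Real.log (homNorm P G y), y))
      ((continuousAt_log_homNorm hP h hx).prodMk continuousAt_id)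
  refine h1.congr ?_
  filter_upwards [isOpen_ne.mem_nhds hx] with y hy
  exact (hg y hy w).symm

/-! ### Sufficiency -/

/-- If the velocities on the boundary of the ellipsoid do not point outwards, then just outside of
it the growth rate of `V(x) = xᵀPx` is at most proportional to `V(x) - 1`. -/
theorem exists_form_velocity_le (hP : P.PosDef) (hQ : Q.PosDef) (h : IsStrictlyMonotone P G)
    (hin : ∀ x w, x ⬝ᵥ (P *ᵥ x) = 1 → w ⬝ᵥ (Q *ᵥ w) ≤ 1 →
      x ⬝ᵥ (P *ᵥ (A₀ *ᵥ x + C *ᵥ x + D *ᵥ w)) ≤ 0) :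
    ∃ k r : ℝ, 0 < r ∧ ∀ x w, 0 < x ⬝ᵥ (P *ᵥ x) - 1 → x ⬝ᵥ (P *ᵥ x) - 1 < r →
      w ⬝ᵥ (Q *ᵥ w) ≤ 1 →
      2 * (x ⬝ᵥ (P *ᵥ sliceField A₀ C D G μ (Real.log (homNorm P G x)) x w)) ≤
        k * (x ⬝ᵥ (P *ᵥ x) - 1) := by
  obtain ⟨b, hb, hexp⟩ := h.exists_exp_mul_le hP
  -- `Φ s y w` is the velocity of `V` at `x = d(s)y`; it is Lipschitz in `s` on compact sets.
  set Φ : ℝ × (Fin n → ℝ) × (Fin p → ℝ) → ℝ := fun q =>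
    2 * ((dilation G q.1 *ᵥ q.2.1) ⬝ᵥ
      (P *ᵥ sliceField A₀ C D G μ q.1 (dilation G q.1 *ᵥ q.2.1) q.2.2)) with hΦ
  have hΦc : ContDiff ℝ 1 Φ := by
    have h1 : ContDiff ℝ 1 fun q : ℝ × (Fin n → ℝ) × (Fin p → ℝ) => dilation G q.1 *ᵥ q.2.1 :=
      contDiff_dilation_mulVec G contDiff_fst contDiff_snd.fst
    exact contDiff_const.mul (contDiff_dotProduct h1 (contDiff_const_mulVec P
      (contDiff_sliceField A₀ C D G μ contDiff_fst h1 contDiff_snd.snd)))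
  obtain ⟨L, hL⟩ := (locallyLipschitzOn_univ.2 hΦc.locallyLipschitz |>.mono
    (subset_univ _)).exists_lipschitzOnWith_of_compact
      ((isCompact_Icc (a := (0 : ℝ)) (b := 1)).prod
        ((isCompact_form_le hP 1).prod (isCompact_form_le hQ 1)))
  refine ⟨L / (2 * b), 2 * b, by positivity, fun x w hx1 hx2 hw => ?_⟩
  have hx : x ≠ 0 := by
    rintro rfl
    simp at hx1
    linarith
  set s := Real.log (homNorm P G x)
  have hs : 0 < s := by
    refine (lt_log_homNorm_iff hP h hx 0).2 ?_
    rw [neg_zero, dilation_zero, one_mulVec]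
    linarith
  set y := dilation G (-s) *ᵥ x with hy
  have hy1 : y ⬝ᵥ (P *ᵥ y) = 1 := form_dilation_neg_log_homNorm hP h hx
  have hxy : dilation G s *ᵥ y = x := by
    rw [hy, dilation_mulVec_mulVec, add_neg_cancel, dilation_zero, one_mulVec]
  have hV : 2 * b * s ≤ x ⬝ᵥ (P *ᵥ x) - 1 := by
    have h1 := hexp s hs.le y
    rw [hxy, hy1, mul_one] at h1
    linarith [Real.add_one_le_exp (2 * b * s)]
  have hs1 : s ≤ 1 := by nlinarith
  have hlip := hL.dist_le_mul (s, y, w) ⟨⟨hs.le, hs1⟩, hy1.le, hw⟩ (0, y, w)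
    ⟨⟨le_rfl, zero_le_one⟩, hy1.le, hw⟩
  have hdist : dist (s, y, w) ((0 : ℝ), y, w) = s := by
    simp [Prod.dist_eq, abs_of_pos hs, hs.le]
  rw [hdist, Real.dist_eq] at hlip
  have hΦs : Φ (s, y, w) = 2 * (x ⬝ᵥ (P *ᵥ sliceField A₀ C D G μ s x w)) := by
    simp only [hΦ, hxy]
  have hΦ0 : Φ (0, y, w) ≤ 0 := by
    simp only [hΦ, dilation_zero, one_mulVec, sliceField_zero]
    exact mul_nonpos_of_nonneg_of_nonpos two_pos.le (hin y w hy1 hw)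
  rw [← hΦs]
  calc Φ (s, y, w) ≤ L * s := by linarith [le_abs_self (Φ (s, y, w) - Φ (0, y, w))]
    _ = L / (2 * b) * (2 * b * s) := by field
    _ ≤ _ := by gcongr

theorem isInvariantEllipsoid_of_velocity_le (hP : P.PosDef) (hQ : Q.PosDef)
    (h : IsStrictlyMonotone P G)
    (hg : ∀ x, x ≠ 0 → ∀ w, g x w = sliceField A₀ C D G μ (Real.log (homNorm P G x)) x w)
    (hin : ∀ x w, x ⬝ᵥ (P *ᵥ x) = 1 → w ⬝ᵥ (Q *ᵥ w) ≤ 1 →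
      x ⬝ᵥ (P *ᵥ (A₀ *ᵥ x + C *ᵥ x + D *ᵥ w)) ≤ 0) :
    IsInvariantEllipsoid g Q P G := by
  refine ⟨hP, h, fun ω hω T hT x hx hx0 => ?_⟩
  obtain ⟨k, r, hr, hk⟩ := exists_form_velocity_le (μ := μ) hP hQ h hin
  have hVc : ContDiff ℝ 1 fun x : Fin n → ℝ => x ⬝ᵥ (P *ᵥ x) - 1 :=
    (contDiff_dotProduct contDiff_id
      (contDiff_const_mulVec P contDiff_id)).sub contDiff_const
  rw [mem_homEllipsoid_iff hP h] at hx0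
  have hae : ∀ᵐ t ∂(volume.restrict (Ioo (0 : ℝ) T)), ω t ⬝ᵥ (Q *ᵥ ω t) ≤ 1 :=
    ae_restrict_of_ae_restrict_of_subset Ioo_subset_Ioi_self hω.2
  have hbar := nonpos_of_ae_deriv_le_mul (C := k) hr (hx.1.comp_contDiff hVc) (by linarith) (by
    filter_upwards [hae, hx.2] with t hωt hxt hpos hlt
    obtain ⟨v, hv, hd⟩ := hxt
    have hne : x t ≠ 0 := by
      intro h0
      simp [h0] at hpos
      linarith
    rw [filippov_sliceField hP h hg hne, mem_singleton_iff] at hv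
    refine ⟨_, (hasDerivAt_form hP hd).sub_const 1, ?_⟩
    rw [hv, hg _ hne]
    exact hk _ _ hpos hlt hωt)
  intro t ht
  rw [mem_homEllipsoid_iff hP h]
  linarith [hbar t ht]

end Slice

/-! ### Necessity -/

section Necessity

variable {n p : ℕ} {A₀ C : Matrix (Fin n) (Fin n) ℝ} {D : Matrix (Fin n) (Fin p) ℝ}
  {G : Matrix (Fin n) (Fin n) ℝ} {μ : ℝ} {P : Matrix (Fin n) (Fin n) ℝ}
  {Q : Matrix (Fin p) (Fin p) ℝ} {g : (Fin n → ℝ) → (Fin p → ℝ) → Fin n → ℝ}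

theorem isAdmissible_const {w : Fin p → ℝ} (hw : w ⬝ᵥ (Q *ᵥ w) ≤ 1) :
    IsAdmissible Q fun _ => w :=
  ⟨memLp_top_const w, Filter.Eventually.of_forall fun _ => hw⟩

theorem _root_.AbsolutelyContinuousOnInterval.of_hasDerivAt {E : Type*} [NormedAddCommGroup E]
    [NormedSpace ℝ E] {x x' : ℝ → E} {a b : ℝ} (hx : ∀ t ∈ uIcc a b, HasDerivAt x (x' t) t)
    (hx' : ContinuousOn x' (uIcc a b)) : AbsolutelyContinuousOnInterval x a b := by
  obtain ⟨c, hc⟩ := isCompact_uIcc.exists_bound_of_continuousOn hx'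
  refine LipschitzOnWith.absolutelyContinuousOnInterval (K := c.toNNReal) ?_
  refine (convex_uIcc a b).lipschitzOnWith_of_nnnorm_hasDerivWithin_le
    (fun t ht => (hx t ht).hasDerivWithinAt) fun t ht => ?_
  rw [← NNReal.coe_le_coe, coe_nnnorm]
  exact (hc t ht).trans (Real.le_coe_toNNReal c)

/-- Local solutions of the closed loop for a constant perturbation. The homogeneous norm need not
be differentiated: the logarithm `s` of the homogeneous norm is adjoined as an unknown, with `ṡ`
chosen such that `‖d(-s)x‖_P` is conserved. The extended vector field is `C¹`. -/
theorem exists_isSolutionOn (hP : P.PosDef) (h : IsStrictlyMonotone P G)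
    (hg : ∀ x, x ≠ 0 → ∀ w, g x w = sliceField A₀ C D G μ (Real.log (homNorm P G x)) x w)
    {x₀ : Fin n → ℝ} (hx₀ : x₀ ⬝ᵥ (P *ᵥ x₀) = 1) (w : Fin p → ℝ) :
    ∃ T : ℝ, 0 < T ∧ ∃ x : ℝ → Fin n → ℝ, x 0 = x₀ ∧ IsSolutionOn g (fun _ => w) T x ∧
      HasDerivAt x (A₀ *ᵥ x₀ + C *ᵥ x₀ + D *ᵥ w) 0 := by
  have hne : x₀ ≠ 0 := by
    rintro rfl
    simp at hx₀
  set F : ℝ × (Fin n → ℝ) → Fin n → ℝ := fun q => sliceField A₀ C D G μ q.1 q.2 w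
  set y : ℝ × (Fin n → ℝ) → Fin n → ℝ := fun q => dilation G (-q.1) *ᵥ q.2 with hy
  set σ : ℝ × (Fin n → ℝ) → ℝ := fun q =>
    (y q ⬝ᵥ (P *ᵥ (dilation G (-q.1) *ᵥ F q))) / (y q ⬝ᵥ ((P * G) *ᵥ y q)) with hσ
  have hF : ContDiff ℝ 1 F := contDiff_sliceField A₀ C D G μ contDiff_fst contDiff_snd contDiff_const
  have hyc : ContDiff ℝ 1 y := contDiff_dilation_mulVec G contDiff_fst.neg contDiff_snd
  have hden : ∀ q : ℝ × (Fin n → ℝ), q.2 ≠ 0 → 0 < y q ⬝ᵥ ((P * G) *ᵥ y q) := fun q hq =>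
    (isStrictlyMonotone_iff hP).1 h _ (dilation_mulVec_ne_zero G _ hq)
  have hσc : ContDiffAt ℝ 1 σ (0, x₀) :=
    (contDiff_dotProduct hyc (contDiff_const_mulVec P
      (contDiff_dilation_mulVec G contDiff_fst.neg hF))).contDiffAt.div
      (contDiff_dotProduct hyc (contDiff_const_mulVec (P * G) hyc)).contDiffAt
      (hden (0, x₀) hne).ne'
  obtain ⟨α, hα0, ε, hε, hα⟩ :=
    (hσc.prodMk hF.contDiffAt).exists_forall_mem_closedBall_exists_eq_forall_mem_Ioo_hasDerivAt₀ 0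
  have hnear : ∀ᶠ t in nhds (0 : ℝ), (α t).2 ≠ 0 := by
    have hc : ContinuousAt (fun t => (α t).2) 0 :=
      (hα 0 (by simp [hε])).continuousAt.snd
    exact hc.eventually_ne (by simpa [hα0] using hne)
  obtain ⟨δ, hδ, hball⟩ := Metric.eventually_nhds_iff.1 hnear
  set T := min (ε / 2) (δ / 2) with hT
  have hTpos : 0 < T := lt_min (by linarith) (by linarith)
  have hderiv : ∀ t ∈ Icc 0 T, HasDerivAt α (σ (α t), F (α t)) t := fun t ht => hα t
    ⟨by linarith [ht.1], by linarith [ht.2, min_le_left (ε / 2) (δ / 2)]⟩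
  have hαne : ∀ t ∈ Icc 0 T, (α t).2 ≠ 0 := fun t ht => hball (by
    rw [Real.dist_eq, sub_zero, abs_of_nonneg ht.1]
    linarith [ht.2, min_le_right (ε / 2) (δ / 2)])
  have hs : ∀ t ∈ Icc 0 T, HasDerivAt (fun t => (α t).1) (σ (α t)) t := fun t ht =>
    (hderiv t ht).fst
  have hx : ∀ t ∈ Icc 0 T, HasDerivAt (fun t => (α t).2) (F (α t)) t := fun t ht =>
    (hderiv t ht).snd
  -- The choice of `σ` makes `‖d(-s)x‖_P` constant along the solution.
  have hW : ∀ t ∈ Icc 0 T, HasDerivAt (fun t => y (α t) ⬝ᵥ (P *ᵥ y (α t))) 0 t := fun t ht => by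
    refine (hasDerivAt_form hP
      (hasDerivAt_dilation_mulVec G (hs t ht).fun_neg (hx t ht))).congr_deriv ?_
    change 2 * (y (α t) ⬝ᵥ (P *ᵥ (-σ (α t) • (G *ᵥ y (α t)) +
      dilation G (-(α t).1) *ᵥ F (α t)))) = 0
    rw [mulVec_add, mulVec_smul, dotProduct_add, dotProduct_smul, mulVec_mulVec, smul_eq_mul,
      neg_mul, hσ]
    simp only
    rw [div_mul_cancel₀ _ (hden _ (hαne t ht)).ne', neg_add_cancel, mul_zero]
  have hone : ∀ t ∈ Icc 0 T, y (α t) ⬝ᵥ (P *ᵥ y (α t)) = 1 := fun t ht => by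
    rw [constant_of_has_deriv_right_zero (f := fun t => y (α t) ⬝ᵥ (P *ᵥ y (α t)))
      (fun t ht => (hW t ht).continuousAt.continuousWithinAt)
      (fun t ht => (hW t ⟨ht.1, ht.2.le⟩).hasDerivWithinAt) t ht]
    simp [hα0, hy, hx₀]
  refine ⟨T, hTpos, fun t => (α t).2, by simp [hα0], ⟨?_, ?_⟩, ?_⟩
  · rw [← uIcc_of_le hTpos.le] at hx hderiv
    exact AbsolutelyContinuousOnInterval.of_hasDerivAt hx fun t ht =>
      (hF.continuous.continuousAt.comp (hderiv t ht).continuousAt).continuousWithinAt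
  · filter_upwards [ae_restrict_mem measurableSet_Ioo] with t ht
    have ht' := Ioo_subset_Icc_self ht
    refine ⟨g (α t).2 w, ?_, ?_⟩
    · rw [filippov_sliceField hP h hg (hαne t ht')]
      rfl
    · rw [hg _ (hαne t ht'), log_homNorm_eq hP h (hαne t ht') (hone t ht')]
      exact hx t ht'
  · have := hx 0 ⟨le_rfl, hTpos.le⟩
    simpa only [F, hα0, sliceField_zero] using this

/-- On the boundary of an invariant ellipsoid no admissible velocity points outwards. -/
theorem IsInvariantEllipsoid.velocity_le (hinv : IsInvariantEllipsoid g Q P G)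
    (hg : ∀ x, x ≠ 0 → ∀ w, g x w = sliceField A₀ C D G μ (Real.log (homNorm P G x)) x w)
    (x₀ : Fin n → ℝ) (w : Fin p → ℝ) (hx₀ : x₀ ⬝ᵥ (P *ᵥ x₀) = 1) (hw : w ⬝ᵥ (Q *ᵥ w) ≤ 1) :
    x₀ ⬝ᵥ (P *ᵥ (A₀ *ᵥ x₀ + C *ᵥ x₀ + D *ᵥ w)) ≤ 0 := by
  obtain ⟨hP, h, hinv⟩ := hinv
  obtain ⟨T, hT, x, hx0, hsol, hd⟩ := exists_isSolutionOn hP h hg hx₀ w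
  have hle := hinv _ (isAdmissible_const hw) T hT x hsol
    (by rw [mem_homEllipsoid_iff hP h, hx0, hx₀])
  -- `V(x(t)) ≤ V(x(0)) = 1` on `[0, T]`, so the right derivative of `V` at `0` is not positive.
  have hV := hasDerivAt_form hP hd
  rw [hx0] at hV
  have hslope := (hasDerivAt_iff_tendsto_slope_zero.1 hV).mono_left
    (nhdsWithin_mono 0 (s := Ioi (0 : ℝ)) fun t (ht : 0 < t) => ht.ne')
  have hnonpos := le_of_tendsto hslope (b := 0) (by
    filter_upwards [Ioc_mem_nhdsGT hT] with t ht
    have h1 := (mem_homEllipsoid_iff hP h _).1 (hle t ⟨ht.1.le, ht.2⟩)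
    rw [zero_add, hx0, hx₀, smul_eq_mul]
    exact mul_nonpos_of_nonneg_of_nonpos (inv_nonneg.2 ht.1.le) (by linarith))
  linarith

end Necessity

end HomEllipsoid

end

theorem theorem3 {n m p : ℕ} (hn : 3 ≤ n)
    (A : Matrix (Fin n) (Fin n) ℝ) (B : Matrix (Fin n) (Fin m) ℝ) (D : Matrix (Fin n) (Fin p) ℝ)
    (Q : Matrix (Fin p) (Fin p) ℝ) (hQ : Q.PosDef) (hD : D ≠ 0)
    (hAB : HomEllipsoid.Controllable A B)
    (G₀ : Matrix (Fin n) (Fin n) ℝ) (Y₀ : Matrix (Fin m) (Fin n) ℝ)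
    (hG₀Y₀ : A * G₀ - G₀ * A + B * Y₀ = A) (hG₀B : G₀ * B = 0)
    (μ : ℝ) (hμ : μ ∈ Set.Icc (-1 : ℝ) (1 / (HomEllipsoid.ctrbIndex A B : ℝ)))
    (X : Matrix (Fin n) (Fin n) ℝ) (K : Matrix (Fin m) (Fin n) ℝ)
    (Gω : Matrix (Fin p) (Fin p) ℝ) (hGω : HomEllipsoid.IsAntiHurwitz Gω)
    (hhom : HomEllipsoid.IsHomogeneousField
      (HomEllipsoid.blockDilation (HomEllipsoid.genG G₀ μ) Gω) μ
      (HomEllipsoid.augField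
        (HomEllipsoid.closedLoop A B D (HomEllipsoid.controller G₀ Y₀ K X μ)))) :
    HomEllipsoid.IsInvariantEllipsoid
        (HomEllipsoid.closedLoop A B D (HomEllipsoid.controller G₀ Y₀ K X μ))
        Q X⁻¹ (HomEllipsoid.genG G₀ μ) ↔
      ∃ β : ℝ, 0 < β ∧
        (-(HomEllipsoid.matW (HomEllipsoid.matA₀ A B G₀ Y₀) B D Q X (K * X) β)).PosSemidef ∧
        (HomEllipsoid.genG G₀ μ * X + X * (HomEllipsoid.genG G₀ μ)ᵀ).PosDef ∧
        X.PosDef := by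
  open HomEllipsoid in
  constructor
  · intro hinv
    have hX := posDef_of_posDef_inv hinv.1
    obtain ⟨β, hβ, hW⟩ := exists_posSemidef_neg_matW (matA₀ A B G₀ Y₀) B D K hD hX hQ
      (hinv.velocity_le fun x hx w => closedLoop_controller_eq A B D G₀ Y₀ K X μ hx w)
    exact ⟨β, hβ, hW, (posDef_mul_add_mul_transpose_iff hX _).2
      ((isStrictlyMonotone_iff hinv.1).1 hinv.2.1), hX⟩
  · rintro ⟨β, hβ, hW, hG, hX⟩
    refine isInvariantEllipsoid_of_velocity_le hX.inv hQ
      ((isStrictlyMonotone_iff hX.inv).2 ((posDef_mul_add_mul_transpose_iff hX _).1 hG))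
      (fun x hx w => closedLoop_controller_eq A B D G₀ Y₀ K X μ hx w) fun x w hx hw => ?_
    have := (posSemidef_neg_matW_iff _ B D K hX hQ β).1 hW x w
    rw [hx] at this
    nlinarith
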